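/- Let $G$ be a finite group. Characters are complex characters, and $\mathrm{Irr}(G)$ is the set of irreducible characters of $G$. For $N \trianglelefteq G$ and $\theta \in \mathrm{Irr}(N)$, let $\mathrm{Irr}(G|\theta)$ be the set of all $\chi \in \mathrm{Irr}(G)$ whose restriction to $N$ has $\theta$ as a constituent, and let $\mathrm{Lin}_G(N)$ be the set of all $\theta \in \mathrm{Irr}(N)$ with $\theta(1)=1$ that are $G$-invariant, i.e. $\theta(gng^{-1})=\theta(n)$ for all $g\in G$, $n \in N$. The group $G$ is called an nMI-group if for every $\chi \in \mathrm{Irr}(G)$ there are $H \trianglelefteq G$ and $\lambda \in \mathrm{Lin}_G(H)$ with $\mathrm{Irr}(G|\lambda)=\{\chi\}$. A normal subgroup $N$ of $G$ is called a $G$-invariant nMI-subgroup if for every $\theta \in \mathrm{Irr}(N)$ there are $H \trianglelefteq G$ with $H \le N$ and $\lambda \in \mathrm{Lin}_G(H)$ with $\mathrm{Irr}(G|\theta)=\mathrm{Irr}(G|\lambda)$. Let $\Gamma_1(G)=G$ and $\Gamma_{i+1}(G)=[\Gamma_i(G),G]$ be the lower central series, and $\ker\chi=\{g\in G : \chi(g)=\chi(1)\}$.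 Suppose that $G$ is an nMI-group and let $1=f_1<f_2<\cdots<f_n$ be the distinct degrees of the irreducible characters of $G$. Then: 1. for every $i\in\{1,\dots,n\}$ and every $\chi\in\mathrm{Irr}(G)$ with $\chi(1)=f_i$, $\Gamma_{i+1}(G)\le\ker(\chi)$; 2. $G$ is nilpotent, of nilpotency class at most $n$; 3. every normal subgroup of $G$ is a $G$-invariant nMI-subgroup of $G$. -/

import Mathlib

noncomputable section

namespace NMI

/-- `Irr(G)`: the set of characters of the irreducible complex representations of `G` of finite
dimension (every such representation is equivalent to one on some `ℂ^d`). -/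
def irr (G : Type*) [Group G] : Set (G → ℂ) :=
  {χ | ∃ (d : ℕ) (ρ : Representation ℂ G (Fin d → ℂ)), ρ.IsIrreducible ∧ ρ.character = χ}

/-- The inner product `[φ, ψ] = |G|⁻¹ ∑ g, φ(g) ψ(g⁻¹)` of two characters of a finite group `G`
(for a character, `ψ(g⁻¹)` is the complex conjugate of `ψ(g)`). -/
def charInner {G : Type*} [Group G] (φ ψ : G → ℂ) : ℂ :=
  (Nat.card G : ℂ)⁻¹ * ∑ᶠ g : G, φ g * ψ g⁻¹

/-- The kernel `{g | χ(g) = χ(1)}` of a character. -/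
def charKer {G : Type*} [Group G] (χ : G → ℂ) : Set G :=
  {g | χ g = χ 1}

/-- The set of degrees of the irreducible characters of `G`. -/
def charDegrees (G : Type*) [Group G] : Set ℕ :=
  {d | ∃ χ ∈ irr G, χ 1 = (d : ℂ)}

/-- `Irr(G | θ)`: the irreducible characters of `G` whose restriction to `N` has the irreducible
character `θ` of `N` as a constituent. -/
def irrOver {G : Type*} [Group G] (N : Subgroup G) (θ : N → ℂ) : Set (G → ℂ) :=
  {χ | χ ∈ irr G ∧ charInner (fun n : N => χ n) θ ≠ 0}

/-- `Lin_G(N)`: the linear `G`-invariant characters of the normal subgroup `N`. -/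
def linInv {G : Type*} [Group G] (N : Subgroup G) [N.Normal] : Set (N → ℂ) :=
  {θ | θ ∈ irr N ∧ θ 1 = 1 ∧ ∀ (g : G) (n : N), θ (MulAut.conjNormal g n) = θ n}

/-- `(H, μ)` is a linear character pair with respect to `χ ∈ Irr(G)`. -/
def IsLinearCharPair {G : Type*} [Group G] (χ : G → ℂ) (H : Subgroup G) (μ : H → ℂ) : Prop :=
  ∃ _ : H.Normal, μ ∈ linInv H ∧ irrOver H μ = {χ}

/-- `G` is an nMI-group. -/
def IsNMIGroup (G : Type*) [Group G] : Prop :=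
  ∀ χ ∈ irr G, ∃ (H : Subgroup G) (μ : H → ℂ), IsLinearCharPair χ H μ

/-- `(H, μ)` is a linear `G`-invariant character pair with respect to `θ ∈ Irr(N)`, where `N` is a
normal subgroup of `G`. -/
def IsLinearInvCharPair {G : Type*} [Group G] (N : Subgroup G) (θ : N → ℂ)
    (H : Subgroup G) (μ : H → ℂ) : Prop :=
  H ≤ N ∧ ∃ _ : H.Normal, μ ∈ linInv H ∧ irrOver N θ = irrOver H μ

/-- The subgroup `N` of `G` is a `G`-invariant nMI-subgroup. -/
def IsInvNMISubgroup {G : Type*} [Group G] (N : Subgroup G) : Prop :=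
  N.Normal ∧ ∀ θ ∈ irr N, ∃ (H : Subgroup G) (μ : H → ℂ), IsLinearInvCharPair N θ H μ

end NMI

end

/-! Let `ρ` be irreducible of degree `d`, with pair `(H, m)` from the nMI property. Then `H` acts by
the scalars `m`, and since `Irr(G|m)` is a singleton, the character of `ρ` vanishes off `H`. Norm
one gives `d² |H| = |G|`.

If `σ` is irreducible and trivial on `H`, its own pair `(K, k)` has `H ≤ K`, because its character
is nonzero on `H`. Comparing orders, either `σ` has degree below `d`, or `K = H` and `σ` is trivial
(`lt_or_eq_one_of_isFullyRamified`). By induction on degrees `Γ_i` acts trivially in all irreducible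
representations of `G/H`, so `Γ_i ≤ H`; then `Γ_{i+1} ≤ [H, G]` acts trivially in `ρ`, where `H` is
scalar. Irreducible representations separate points, which bounds the class.

For normal `N` and `θ ∈ Irr(N)`, take `ρ` over `θ` with pair `(Z, l)` and restrict `l` to `Z ∩ N`.
The vanishing of `ρ` off `Z` and Clifford's conjugation argument give the third claim. -/

noncomputable section

namespace NMI

open Representation

/-! ### Irreducible representations and the group algebra -/

section General

variable {G : Type*} [Group G] {V : Type*} [AddCommGroup V] [Module ℂ V]

theorem isIrreducible_of_forall_submodule [Nontrivial V] (ρ : Representation ℂ G V)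
    (h : ∀ p : Submodule ℂ V, (∀ g, ∀ v ∈ p, ρ g v ∈ p) → p = ⊥ ∨ p = ⊤) : ρ.IsIrreducible := by
  have : Nontrivial (Subrepresentation ρ) := by
    refine ⟨⊥, ⊤, fun e => ?_⟩
    have := congrArg Subrepresentation.toSubmodule e
    exact bot_ne_top (α := Submodule ℂ V) this
  refine ⟨fun p => ?_⟩
  refine (h p.toSubmodule fun g v hv => p.apply_mem_toSubmodule g hv).imp ?_ ?_ <;> intro e <;>
    exact Subrepresentation.toSubmodule_injective e

theorem submodule_eq_top_of_isIrreducible {ρ : Representation ℂ G V} (hρ : ρ.IsIrreducible)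
    (p : Submodule ℂ V) (hp : ∀ g, ∀ v ∈ p, ρ g v ∈ p) (hne : p ≠ ⊥) : p = ⊤ := by
  let q : Subrepresentation ρ := ⟨p, fun g v hv => hp g v hv⟩
  rcases hρ.eq_bot_or_eq_top q with h | h
  · exact absurd (congrArg Subrepresentation.toSubmodule h) hne
  · exact congrArg Subrepresentation.toSubmodule h

theorem nontrivial_of_isIrreducible {ρ : Representation ℂ G V} (hρ : ρ.IsIrreducible) :
    Nontrivial V := by
  by_contra h
  rw [not_nontrivial_iff_subsingleton] at h
  obtain ⟨p, q, hpq⟩ := hρ.toNontrivial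
  exact hpq (Subrepresentation.toSubmodule_injective (Subsingleton.elim _ _))

theorem exists_eq_smul_one_of_commute [FiniteDimensional ℂ V] {ρ : Representation ℂ G V}
    (hρ : ρ.IsIrreducible) (T : Module.End ℂ V) (hT : ∀ g, T * ρ g = ρ g * T) :
    ∃ c : ℂ, T = c • 1 := by
  let f : IntertwiningMap ρ ρ := ⟨T, fun g => hT g⟩
  obtain ⟨c, hc⟩ := (IsIrreducible.algebraMap_intertwiningMap_bijective_of_isAlgClosed (ρ := ρ)).2 f
  refine ⟨c, ?_⟩
  have := congrArg IntertwiningMap.toLinearMap hc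
  rw [IntertwiningMap.algebraMap_apply] at this
  exact this.symm

/-- Irreducible representations separate the elements of the group algebra. -/
theorem exists_isIrreducible_asAlgebraHom_ne_zero [Finite G] {a : MonoidAlgebra ℂ G} (ha : a ≠ 0) :
    ∃ (d : ℕ) (ρ : Representation ℂ G (Fin d → ℂ)), ρ.IsIrreducible ∧ ρ.asAlgebraHom a ≠ 0 := by
  -- By Maschke the Jacobson radical is zero, so some maximal left ideal misses `a`; on the simple
  -- quotient, `a` does not kill the class of `1`.
  have hJ := IsSemisimpleRing.jacobson_eq_bot (R := MonoidAlgebra ℂ G)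
  rw [Ring.jacobson_eq_sInf_isMaximal] at hJ
  obtain ⟨I, hI, haI⟩ : ∃ I : Ideal (MonoidAlgebra ℂ G), I.IsMaximal ∧ a ∉ I := by
    by_contra! h
    have : a ∈ sInf {I : Ideal (MonoidAlgebra ℂ G) | I.IsMaximal} :=
      Submodule.mem_sInf.2 fun I hI => h I hI
    rw [hJ] at this
    exact ha this
  let M := MonoidAlgebra ℂ G ⧸ I
  have : Module.Finite ℂ M := inferInstance
  have hs : IsSimpleModule (MonoidAlgebra ℂ G) M := isSimpleModule_iff_isCoatom.2 hI.out
  let d := Module.finrank ℂ M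
  let e : M ≃ₗ[ℂ] (Fin d → ℂ) := (Module.finBasis ℂ M).equivFun
  let φ : MonoidAlgebra ℂ G →ₐ[ℂ] Module.End ℂ (Fin d → ℂ) :=
    (LinearEquiv.conjAlgEquiv ℂ e).toAlgHom.comp (Algebra.lsmul ℂ ℂ M)
  have hφ : ∀ r v, φ r v = e (r • e.symm v) := fun r v => rfl
  let ρ : Representation ℂ G (Fin d → ℂ) := (φ : _ →* _).comp (MonoidAlgebra.of ℂ G)
  have hρφ : ρ.asAlgebraHom = φ :=
    (MonoidAlgebra.lift ℂ (Module.End ℂ (Fin d → ℂ)) G).apply_symm_apply φ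
  have : Nontrivial M := hs.nontrivial
  have : Nontrivial (Fin d → ℂ) := e.symm.toEquiv.nontrivial
  refine ⟨d, ρ, isIrreducible_of_forall_submodule ρ fun p hp => ?_, fun h0 => haI ?_⟩
  · have hp' : ∀ r : MonoidAlgebra ℂ G, ∀ v ∈ p, φ r v ∈ p := by
      intro r v hv
      induction r using MonoidAlgebra.induction_on with
      | of g => exact hp g v hv
      | add x y hx hy => rw [map_add]; exact p.add_mem hx hy
      | smul c x hx => rw [map_smul]; exact p.smul_mem c hx
    let q : Submodule (MonoidAlgebra ℂ G) M :=
      { carrier := {m | e m ∈ p}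
        add_mem' := fun {x y} hx hy => by
          simp only [Set.mem_ofPred_eq, map_add] at *; exact p.add_mem hx hy
        zero_mem' := by simp
        smul_mem' := fun r m hm => by
          have := hp' r _ hm
          rwa [hφ, e.symm_apply_apply] at this }
    rcases eq_bot_or_eq_top q with hq | hq
    · left
      rw [eq_bot_iff]
      intro v hv
      have : e.symm v ∈ q := by change e (e.symm v) ∈ p; simpa using hv
      rw [hq, Submodule.mem_bot] at this
      simpa using this
    · right
      rw [eq_top_iff]
      intro v _
      have : e.symm v ∈ q := by rw [hq]; trivial
      change e (e.symm v) ∈ p at this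
      simpa using this
  · rw [hρφ] at h0
    have := hφ a (e (Submodule.Quotient.mk 1))
    rw [h0, e.symm_apply_apply, LinearMap.zero_apply, eq_comm, e.map_eq_zero_iff,
      ← Submodule.Quotient.mk_smul, Submodule.Quotient.mk_eq_zero] at this
    simpa using this

end General

/-- The hypothesis says that the coefficient at `1` of a group algebra element is nonzero. Later
existence proofs only choose the element and compute this coefficient. -/
theorem exists_isIrreducible_sum_smul_ne_zero {G : Type*} [Group G] [Finite G] {ι : Type*}
    [Fintype ι] (x : ι → G) (c : ι → ℂ) [∀ i, Decidable (x i = 1)]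
    (h : ∑ i, (if x i = 1 then c i else 0) ≠ 0) :
    ∃ (d : ℕ) (ρ : Representation ℂ G (Fin d → ℂ)),
      ρ.IsIrreducible ∧ ∑ i, c i • ρ (x i) ≠ 0 := by
  classical
  have ha : ∑ i, MonoidAlgebra.single (x i) (c i) ≠ 0 := by
    intro h0
    apply h
    have := congrArg (fun a : MonoidAlgebra ℂ G => a.coeff 1) h0
    simpa [Finsupp.single_apply] using this
  obtain ⟨d, ρ, hρ, hne⟩ := exists_isIrreducible_asAlgebraHom_ne_zero ha
  refine ⟨d, ρ, hρ, ?_⟩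
  simpa [map_sum, Representation.asAlgebraHom_single] using hne

theorem sum_eq_sum_subgroup {G : Type*} [Group G] [Fintype G] (H : Subgroup G) [Fintype H]
    (F : G → ℂ) (hF : ∀ g, g ∉ H → F g = 0) : ∑ g, F g = ∑ h : H, F h := by
  classical
  rw [← Finset.sum_subtype (Finset.univ.filter (· ∈ H)) (by simp) F]
  refine (Finset.sum_subset (Finset.subset_univ _) fun g _ hg => hF g ?_).symm
  simpa using hg

/-! ### Inner products as intertwiners; linear characters -/

section

variable {G : Type*} [Group G] {V W : Type*} [AddCommGroup V] [Module ℂ V] [FiniteDimensional ℂ V]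
  [AddCommGroup W] [Module ℂ W] [FiniteDimensional ℂ W]

theorem charInner_character_ne_zero_iff [Finite G] (ρ : Representation ℂ G V)
    (σ : Representation ℂ G W) :
    charInner ρ.character σ.character ≠ 0 ↔
      ∃ f : W →ₗ[ℂ] V, f ≠ 0 ∧ ∀ g w, f (σ g w) = ρ g (f w) := by
  classical
  have := Fintype.ofFinite G
  have : Invertible (Nat.card G : ℂ) := invertibleOfNonzero (by simp)
  rw [charInner, finsum_eq_sum_of_fintype, card_inv_mul_sum_char_mul_char_eq_finrank,
    Nat.cast_ne_zero, ← Nat.pos_iff_ne_zero, Module.finrank_pos_iff_exists_ne_zero]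
  constructor
  · rintro ⟨f, hf⟩
    refine ⟨f.toLinearMap, fun h => hf (IntertwiningMap.ext h), fun g w => ?_⟩
    exact LinearMap.congr_fun (f.isIntertwining' g) w
  · rintro ⟨f, hf, hfg⟩
    refine ⟨⟨f, fun g => LinearMap.ext (hfg g)⟩, fun h => hf ?_⟩
    exact congrArg IntertwiningMap.toLinearMap h

theorem character_mem_irr {d : ℕ} {ρ : Representation ℂ G (Fin d → ℂ)} (hρ : ρ.IsIrreducible) :
    ρ.character ∈ irr G :=
  ⟨d, ρ, hρ, rfl⟩

theorem character_mem_irrOver_iff [Finite G] {d : ℕ} {ρ : Representation ℂ G (Fin d → ℂ)}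
    (hρ : ρ.IsIrreducible) (N : Subgroup G) (σ : Representation ℂ N W) :
    ρ.character ∈ irrOver N σ.character ↔
      ∃ f : W →ₗ[ℂ] (Fin d → ℂ), f ≠ 0 ∧ ∀ (n : N) w, f (σ n w) = ρ n (f w) := by
  rw [irrOver, Set.mem_ofPred_eq, and_iff_right (character_mem_irr hρ)]
  exact charInner_character_ne_zero_iff (ρ.comp N.subtype) σ

theorem eq_trace_smul_one (T : Module.End ℂ (Fin 1 → ℂ)) :
    T = LinearMap.trace ℂ (Fin 1 → ℂ) T • (1 : Module.End ℂ (Fin 1 → ℂ)) := by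
  ext i j
  rw [LinearMap.trace_eq_matrix_trace ℂ (Pi.basisFun ℂ (Fin 1))]
  fin_cases i; fin_cases j
  simp [Matrix.trace]

/-- The representation on `ℂ` afforded by a linear character. -/
def linRep (m : G →* ℂ) : Representation ℂ G ℂ where
  toFun g := m g • 1
  map_one' := by simp
  map_mul' a b := by ext; simp [mul_comm]

theorem linRep_apply (m : G →* ℂ) (g : G) (z : ℂ) : linRep m g z = m g * z := rfl

theorem character_linRep (m : G →* ℂ) : (linRep m).character = m := by
  ext g
  simp [Representation.character, linRep]

theorem exists_monoidHom_of_mem_irr {μ : G → ℂ} (hμ : μ ∈ irr G) (h1 : μ 1 = 1) :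
    ∃ m : G →* ℂ, (m : G → ℂ) = μ := by
  obtain ⟨d, σ, -, rfl⟩ := hμ
  have hd : d = 1 := by simpa using h1
  subst hd
  refine ⟨⟨⟨σ.character, h1⟩, fun a b => ?_⟩, rfl⟩
  have ha := eq_trace_smul_one (σ a)
  simp only [Representation.character, map_mul]
  conv_lhs => rw [ha]
  simp

theorem monoidHom_mem_irr (m : G →* ℂ) : (m : G → ℂ) ∈ irr G := by
  let σ : Representation ℂ G (Fin 1 → ℂ) :=
    ⟨⟨fun g => m g • 1, by simp⟩, fun a b => by ext; simp [mul_assoc, mul_left_comm]⟩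
  refine ⟨1, σ, isIrreducible_of_forall_submodule σ fun p _ => ?_, ?_⟩
  · refine or_iff_not_imp_left.2 fun hp => eq_top_iff.2 fun w _ => ?_
    obtain ⟨v, hv, hv0⟩ := Submodule.exists_mem_ne_zero_of_ne_bot hp
    have hv1 : v 0 ≠ 0 := fun h => hv0 (by ext i; fin_cases i; exact h)
    have : w = (w 0 / v 0) • v := by
      ext i; fin_cases i; simp [hv1]
    exact this ▸ p.smul_mem _ hv
  · ext g
    simp [Representation.character, σ]

end

/-! ### Invariant linear characters of normal subgroups -/

section Linear

variable {G : Type*} [Group G] {H : Subgroup G}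

theorem inv_apply_mul_apply (m : H →* ℂ) (h : H) : m h⁻¹ * m h = 1 := by
  rw [← map_mul, inv_mul_cancel, map_one]

variable {d : ℕ} {ρ : Representation ℂ G (Fin d → ℂ)}

/-- In an irreducible representation, a `G`-invariant linear character of `H` that has an
eigenvector describes the action of `H`. -/
theorem eq_smul_one_of_eigenvector [H.Normal] {μ : H → ℂ}
    (hμ : ∀ (g : G) (h : H), μ (MulAut.conjNormal g h) = μ h) (hρ : ρ.IsIrreducible)
    {v : Fin d → ℂ} (hv : v ≠ 0) (h : ∀ h : H, ρ h v = μ h • v) (x : H) : ρ x = μ x • 1 := by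
  let p : Submodule ℂ (Fin d → ℂ) :=
    { carrier := {v | ∀ h : H, ρ h v = μ h • v}
      add_mem' := fun {a b} ha hb h => by rw [map_add, ha h, hb h, smul_add]
      zero_mem' := fun h => by simp
      smul_mem' := fun c a ha h => by rw [map_smul, ha h, smul_comm] }
  have hp : p = ⊤ := by
    refine submodule_eq_top_of_isIrreducible hρ p (fun g w hw h => ?_) fun h0 => hv ?_
    · have h1 := hw (MulAut.conjNormal g⁻¹ h)
      rw [hμ] at h1
      rw [← map_smul, ← h1, ← Module.End.mul_apply, ← Module.End.mul_apply, ← map_mul, ← map_mul]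
      congr 2
      simp [mul_assoc]
    · have : v ∈ p := h
      rwa [h0] at this
  refine LinearMap.ext fun w => ?_
  have : w ∈ p := hp ▸ Submodule.mem_top
  exact this x

/-- The operator `∑ μ(h⁻¹) ρ(h)`, a multiple of the projection to the `μ`-eigenspace. -/
def eigenProj [Fintype H] (m : H →* ℂ) (ρ : Representation ℂ G (Fin d → ℂ)) :
    Module.End ℂ (Fin d → ℂ) :=
  ∑ h : H, m h⁻¹ • ρ h

theorem apply_eigenProj [Fintype H] (m : H →* ℂ) (x : H) (v : Fin d → ℂ) :
    ρ x (eigenProj m ρ v) = m x • eigenProj m ρ v := by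
  simp only [eigenProj, LinearMap.sum_apply, map_sum, Finset.smul_sum, LinearMap.smul_apply,
    map_smul]
  rw [← Equiv.sum_comp (Equiv.mulLeft x) (fun h : H => m x • m h⁻¹ • ρ h v)]
  refine Finset.sum_congr rfl fun h _ => ?_
  simp only [Equiv.coe_mulLeft, mul_inv_rev, map_mul, Subgroup.coe_mul, smul_smul]
  rw [mul_comm (m h⁻¹), ← mul_assoc, mul_comm (m x), inv_apply_mul_apply, one_mul]
  rfl

theorem character_mem_irrOver_linear_iff [Finite G] (m : H →* ℂ) (hρ : ρ.IsIrreducible) :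
    ρ.character ∈ irrOver H m ↔ ∃ v ≠ 0, ∀ h : H, ρ h v = m h • v := by
  conv_lhs => rw [← character_linRep m]
  rw [character_mem_irrOver_iff hρ]
  constructor
  · rintro ⟨f, hf, hfH⟩
    refine ⟨f 1, fun h0 => hf (LinearMap.ext_ring h0), fun h => ?_⟩
    rw [← hfH, ← map_smul, linRep_apply, smul_eq_mul]
  · rintro ⟨v, hv, hvH⟩
    refine ⟨LinearMap.toSpanSingleton ℂ _ v, fun h0 => hv ?_, fun h z => ?_⟩
    · simpa using LinearMap.congr_fun h0 1
    · rw [linRep_apply, LinearMap.toSpanSingleton_apply, LinearMap.toSpanSingleton_apply, map_smul,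
        hvH, smul_smul, mul_comm]

/-- For a `G`-invariant linear character `m` of `H`, the irreducible representations over `m` are
those in which `H` acts by `m`. -/
theorem character_mem_irrOver_iff_eq_smul_one [Finite G] [H.Normal] (m : H →* ℂ)
    (hm : ∀ (g : G) (h : H), m (MulAut.conjNormal g h) = m h) (hρ : ρ.IsIrreducible) :
    ρ.character ∈ irrOver H m ↔ ∀ h : H, ρ h = m h • 1 := by
  rw [character_mem_irrOver_linear_iff m hρ]
  constructor
  · rintro ⟨v, hv, hvH⟩ x
    exact eq_smul_one_of_eigenvector (μ := m) hm hρ hv hvH x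
  · intro h
    have := nontrivial_of_isIrreducible hρ
    obtain ⟨v, hv⟩ := exists_ne (0 : Fin d → ℂ)
    exact ⟨v, hv, fun x => by rw [h]; rfl⟩

theorem eq_smul_one_of_eigenProj_ne_zero [Fintype H] [H.Normal] (m : H →* ℂ)
    (hm : ∀ (g : G) (h : H), m (MulAut.conjNormal g h) = m h) (hρ : ρ.IsIrreducible)
    (h0 : eigenProj m ρ ≠ 0) (x : H) : ρ x = m x • 1 := by
  obtain ⟨v, hv⟩ : ∃ v, eigenProj m ρ v ≠ 0 := by
    by_contra! h
    exact h0 (LinearMap.ext h)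
  exact eq_smul_one_of_eigenvector (μ := m) hm hρ hv (fun h => apply_eigenProj m h v) x

end Linear

/-! ### Fully ramified characters -/

section

variable {G : Type*} [Group G] {d : ℕ} {ρ : Representation ℂ G (Fin d → ℂ)}

/-- The irreducible representation `ρ` is fully ramified over the `G`-invariant linear character
`m` of the normal subgroup `H`. -/
structure IsFullyRamified (ρ : Representation ℂ G (Fin d → ℂ)) (H : Subgroup G) (m : H →* ℂ) :
    Prop where
  normal : H.Normal
  invariant : ∀ (g : G) (h : H), m (MulAut.conjNormal g h) = m h
  eq_smul_one : ∀ h : H, ρ h = m h • 1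
  character_eq_zero : ∀ g ∉ H, ρ.character g = 0

theorem character_of_eq_smul_one {H : Subgroup G} {m : H →* ℂ} (h : ∀ h : H, ρ h = m h • 1)
    (x : H) : ρ.character x = m x * d := by
  simp [Representation.character, h]

theorem natCast_ne_zero_of_isIrreducible (hρ : ρ.IsIrreducible) : (d : ℂ) ≠ 0 := by
  have := nontrivial_of_isIrreducible hρ
  rintro h
  have : d = 0 := by exact_mod_cast h
  subst this
  exact false_of_nontrivial_of_subsingleton (Fin 0 → ℂ)

/-- The sum commutes with `ρ`, so it is scalar by Schur, and each of its terms has trace zero. -/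
theorem sum_conj_eq_zero [Fintype G] (hρ : ρ.IsIrreducible) (g : G) :
    ∑ y : G, ((d : ℂ) • ρ (y * g * y⁻¹) - ρ.character g • 1) = 0 := by
  obtain ⟨c, hc⟩ := exists_eq_smul_one_of_commute hρ
    (∑ y : G, ((d : ℂ) • ρ (y * g * y⁻¹) - ρ.character g • 1)) fun x => by
      rw [Finset.sum_mul, Finset.mul_sum,
        ← Equiv.sum_comp (Equiv.mulLeft x) (fun y => (_ : Module.End ℂ (Fin d → ℂ)) * ρ x)]
      refine Finset.sum_congr rfl fun y _ => ?_
      simp only [sub_mul, mul_sub, smul_mul_assoc, mul_smul_comm, one_mul, mul_one,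
        Equiv.coe_mulLeft, ← map_mul]
      rw [show x * y * g * (x * y)⁻¹ * x = x * (y * g * y⁻¹) by group]
  have htr := congrArg (LinearMap.trace ℂ (Fin d → ℂ)) hc
  have hconj : ∀ y : G, LinearMap.trace ℂ (Fin d → ℂ) (ρ (y * g * y⁻¹)) = ρ.character g :=
    fun y => ρ.char_conj g y
  simp only [map_sum, map_sub, map_smul, hconj, LinearMap.trace_one, Module.finrank_fin_fun,
    smul_eq_mul, mul_comm (ρ.character g), sub_self, Finset.sum_const_zero] at htr
  rw [hc, (mul_eq_zero.1 htr.symm).resolve_right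
    (natCast_ne_zero_of_isIrreducible hρ), zero_smul]

/-- Multiply `∑ m(h⁻¹) h` by `∑ (d · ygy⁻¹ - χ(g))`. As `g ∉ H`, the coefficient at `1` is `-|G|
χ(g)`. If this is nonzero, some irreducible `σ` does not kill the product. The first factor forces
`σ` to lie over `m`, hence to have character `χ`; but then the second factor acts as zero. -/
theorem character_eq_zero_of_irrOver_eq_singleton [Finite G] {H : Subgroup G} [H.Normal]
    {m : H →* ℂ} (hm : ∀ (g : G) (h : H), m (MulAut.conjNormal g h) = m h)
    (hsing : irrOver H m = {ρ.character}) {g : G} (hg : g ∉ H) :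
    ρ.character g = 0 := by
  classical
  by_contra hχ
  have := Fintype.ofFinite G
  let x : (H × G) ⊕ (H × G) → G := Sum.elim (fun p => p.1 * (p.2 * g * p.2⁻¹)) fun p => p.1
  let c : (H × G) ⊕ (H × G) → ℂ :=
    Sum.elim (fun p => m p.1⁻¹ * d) fun p => -(m p.1⁻¹ * ρ.character g)
  obtain ⟨e, σ, hσ, hne⟩ := exists_isIrreducible_sum_smul_ne_zero x c (by
    have h1 : ∀ p : H × G, (p.1 : G) * (p.2 * g * p.2⁻¹) ≠ 1 := by
      rintro ⟨h, y⟩ h1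
      have h2 : y * g * y⁻¹ ∈ H := by
        rw [eq_inv_of_mul_eq_one_right h1]
        exact H.inv_mem h.2
      apply hg
      have := ‹H.Normal›.conj_mem _ h2 y⁻¹
      simpa [mul_assoc] using this
    have h2 : ∑ h : H, (if h = 1 then m h⁻¹ * ρ.character g else 0) = ρ.character g := by
      simp
    simp only [x, c, Fintype.sum_sum_type, Sum.elim_inl, Sum.elim_inr, h1, if_false,
      Finset.sum_const_zero, zero_add, Fintype.sum_prod_type, Finset.sum_const,
      OneMemClass.coe_eq_one]
    rw [← Finset.smul_sum]
    simpa using hχ)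
  have hfac : ∑ i, c i • σ (x i) =
      eigenProj m σ * ∑ y : G, ((d : ℂ) • σ (y * g * y⁻¹) - ρ.character g • 1) := by
    simp only [x, c, eigenProj, Fintype.sum_sum_type, Sum.elim_inl, Sum.elim_inr,
      Finset.sum_mul_sum, Fintype.sum_prod_type, ← Finset.sum_add_distrib]
    refine Finset.sum_congr rfl fun h _ => Finset.sum_congr rfl fun y _ => ?_
    rw [mul_sub, map_mul σ (h : G), smul_mul_smul_comm, smul_mul_smul_comm, mul_one, sub_eq_add_neg]
    exact congrArg _ (neg_smul (m h⁻¹ * ρ.character g) (σ (h : G)))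
  have hP : eigenProj m σ ≠ 0 := fun h => hne (by rw [hfac, h, zero_mul])
  have hmem := (character_mem_irrOver_iff_eq_smul_one m hm hσ).2
    (eq_smul_one_of_eigenProj_ne_zero m hm hσ hP)
  rw [hsing, Set.mem_singleton_iff] at hmem
  have hde : (e : ℂ) = d := by simpa using congrFun hmem 1
  apply hne
  rw [hfac, ← hmem, ← hde, sum_conj_eq_zero hσ, mul_zero]

theorem exists_isFullyRamified [Finite G] (hG : IsNMIGroup G) (hρ : ρ.IsIrreducible) :
    ∃ (H : Subgroup G) (m : H →* ℂ), IsFullyRamified ρ H m := by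
  obtain ⟨H, μ, hH, ⟨hμ, h1, hinv⟩, hsing⟩ := hG _ (character_mem_irr hρ)
  obtain ⟨m, rfl⟩ := exists_monoidHom_of_mem_irr hμ h1
  refine ⟨H, m, hH, hinv, ?_, fun g hg => character_eq_zero_of_irrOver_eq_singleton hinv hsing hg⟩
  rw [← character_mem_irrOver_iff_eq_smul_one m hinv hρ, hsing]
  rfl

theorem IsFullyRamified.sq_mul_card [Finite G] (hρ : ρ.IsIrreducible) {H : Subgroup G}
    {m : H →* ℂ} (h : IsFullyRamified ρ H m) : d ^ 2 * Nat.card H = Nat.card G := by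
  classical
  have := Fintype.ofFinite G
  have : Invertible (Nat.card G : ℂ) := invertibleOfNonzero (by simp)
  have h1 := char_orthonormal ρ ρ
  rw [if_pos ⟨Representation.Equiv.refl ρ⟩, sum_eq_sum_subgroup H _ fun g hg => by
    rw [h.character_eq_zero g hg, zero_mul]] at h1
  have h2 : ∀ x : H, ρ.character (x : G) * ρ.character (x : G)⁻¹ = (d : ℂ) ^ 2 := fun x => by
    rw [← Subgroup.coe_inv, character_of_eq_smul_one h.eq_smul_one,
      character_of_eq_smul_one h.eq_smul_one]
    linear_combination (d : ℂ) ^ 2 * inv_apply_mul_apply m x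
  simp only [h2, Finset.sum_const, Finset.card_univ, nsmul_eq_mul, ← Nat.card_eq_fintype_card] at h1
  rw [inv_mul_eq_one₀ (by simp)] at h1
  have : (Nat.card G : ℂ) = (d ^ 2 * Nat.card H : ℕ) := by rw [h1]; push_cast; ring
  exact_mod_cast this.symm

theorem eq_one_of_sum_character_ne_zero [Fintype G] (hρ : ρ.IsIrreducible)
    (h : ∑ g, ρ.character g ≠ 0) (g : G) : ρ g = 1 := by
  have : Invertible (Nat.card G : ℂ) := invertibleOfNonzero (by simp)
  have h1 := card_inv_mul_sum_char_eq_finrank ρ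
  have h2 : ρ.invariants ≠ ⊥ := fun h0 => by
    rw [h0, finrank_bot, Nat.cast_zero] at h1
    exact h ((mul_eq_zero.1 h1).resolve_left (by simp))
  have h3 := submodule_eq_top_of_isIrreducible hρ ρ.invariants (fun g v hv => by
    rwa [hv g]) h2
  refine LinearMap.ext fun v => ?_
  have : v ∈ ρ.invariants := h3 ▸ Submodule.mem_top
  exact this g

/-- In an nMI-group, a nontrivial irreducible representation trivial on `H` has smaller degree
than one that is fully ramified over a character of `H`. -/
theorem lt_or_eq_one_of_isFullyRamified [Finite G] (hG : IsNMIGroup G) (hρ : ρ.IsIrreducible)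
    {H : Subgroup G} {m : H →* ℂ} (h : IsFullyRamified ρ H m) {e : ℕ}
    {σ : Representation ℂ G (Fin e → ℂ)} (hσ : σ.IsIrreducible) (hσH : ∀ x ∈ H, σ x = 1) :
    e < d ∨ ∀ g, σ g = 1 := by
  have := Fintype.ofFinite G
  obtain ⟨K, k, hK⟩ := exists_isFullyRamified hG hσ
  have hHK : H ≤ K := fun x hx => by
    by_contra hxK
    have h0 := hK.character_eq_zero x hxK
    rw [Representation.character, hσH x hx] at h0
    exact natCast_ne_zero_of_isIrreducible hσ (by simpa using h0)
  refine or_iff_not_imp_left.2 fun hed => ?_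
  have h1 := h.sq_mul_card hρ
  have h2 := hK.sq_mul_card hσ
  have hcard : Nat.card K ≤ Nat.card H := by
    by_contra! hlt
    have hd : 0 < d := Nat.pos_of_ne_zero fun h0 =>
      natCast_ne_zero_of_isIrreducible hρ (by simp [h0])
    have : d ^ 2 * Nat.card H < e ^ 2 * Nat.card K :=
      Nat.mul_lt_mul_of_le_of_lt (Nat.pow_le_pow_left (not_lt.1 hed) 2) hlt
        (pow_pos (hd.trans_le (not_lt.1 hed)) 2)
    omega
  have hKH : H = K := SetLike.coe_injective
    (Set.eq_of_subset_of_ncard_le hHK (by simpa [← Nat.card_coe_set_eq] using hcard))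
  subst hKH
  classical
  refine eq_one_of_sum_character_ne_zero hσ ?_
  -- With `K = H`, the character of `σ` is `e` on `H` and zero elsewhere, so its sum is nonzero.
  rw [sum_eq_sum_subgroup H _ hK.character_eq_zero]
  have h3 : ∀ x : H, σ.character x = e := fun x => by
    simp [Representation.character, hσH x x.2]
  simp [h3, natCast_ne_zero_of_isIrreducible hσ]

/-- The irreducible representations of `G` trivial on a normal subgroup `H` separate the cosets
of `H`. -/
theorem exists_isIrreducible_ne_one [Finite G] {H : Subgroup G} (hH : H.Normal) {g : G}
    (hg : g ∉ H) :
    ∃ (e : ℕ) (σ : Representation ℂ G (Fin e → ℂ)),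
      σ.IsIrreducible ∧ (∀ x ∈ H, σ x = 1) ∧ σ g ≠ 1 := by
  classical
  have := Fintype.ofFinite G
  -- These data encode `(∑ h) (g - 1)`, whose coefficient at `1` is `-1`.
  let x : H ⊕ H → G := Sum.elim (fun h => h * g) fun h => h
  let c : H ⊕ H → ℂ := Sum.elim (fun _ => 1) fun _ => -1
  obtain ⟨e, σ, hσ, hne⟩ := exists_isIrreducible_sum_smul_ne_zero x c (by
    have h1 : ∀ h : H, (h : G) * g ≠ 1 := fun h h1 => hg (by
      rw [eq_inv_of_mul_eq_one_right h1]
      exact H.inv_mem h.2)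
    simp [x, c, h1])
  have hfac : ∑ i, c i • σ (x i) = eigenProj (1 : H →* ℂ) σ * (σ g - 1) := by
    simp only [x, c, eigenProj, Fintype.sum_sum_type, Sum.elim_inl, Sum.elim_inr, map_mul,
      MonoidHom.one_apply, one_smul, Finset.sum_mul, ← Finset.sum_add_distrib]
    refine Finset.sum_congr rfl fun h _ => ?_
    rw [mul_sub, mul_one, sub_eq_add_neg]
    refine congrArg _ ?_
    exact (neg_smul (1 : ℂ) (σ (h : G))).trans (by rw [one_smul])
  refine ⟨e, σ, hσ, fun y hy => ?_, fun h => hne (by rw [hfac, h, sub_self, mul_zero])⟩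
  have := eq_smul_one_of_eigenProj_ne_zero (1 : H →* ℂ) (fun _ _ => rfl) hσ
    (fun h => hne (by rw [hfac, h, zero_mul])) ⟨y, hy⟩
  simpa using this

theorem IsFullyRamified.eq_one_of_mem_commutator {H : Subgroup G} {m : H →* ℂ}
    (h : IsFullyRamified ρ H m) {x : G} (hx : x ∈ ⁅H, (⊤ : Subgroup G)⁆) : ρ x = 1 := by
  have hle : ⁅H, (⊤ : Subgroup G)⁆ ≤ MonoidHom.ker ρ.asGroupHom := by
    rw [Subgroup.commutator_le]
    intro a ha b _
    rw [MonoidHom.mem_ker, map_commutatorElement, commutatorElement_eq_one_iff_mul_comm]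
    ext1
    have := h.eq_smul_one ⟨a, ha⟩
    simp only [Units.val_mul, Representation.asGroupHom_apply]
    simp only at this
    rw [this, smul_mul_assoc, one_mul, mul_smul_comm, mul_one]
  have := congrArg Units.val (MonoidHom.mem_ker.1 (hle hx))
  simpa [Representation.asGroupHom_apply] using this

end

/-! ### Lower central series and nilpotency -/

section

variable {G : Type*} [Group G]

/-- In an nMI-group with character degrees `f 0 < f 1 < ⋯`, the term of the lower central series
with index `i + 1` acts trivially in the irreducible representations of degree `f i`. -/
theorem lowerCentralSeries_acts_trivially [Finite G] (hG : IsNMIGroup G) {n : ℕ} {f : Fin n → ℕ}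
    (hf : StrictMono f) (hrange : Set.range f = charDegrees G) (i : Fin n) :
    ∀ ρ : Representation ℂ G (Fin (f i) → ℂ), ρ.IsIrreducible →
      ∀ x ∈ (⊤ : Subgroup G).lowerCentralSeries ((i : ℕ) + 1), ρ x = 1 := by
  induction i using WellFoundedLT.induction with
  | ind i ih =>
    intro ρ hρ x hx
    obtain ⟨H, m, h⟩ := exists_isFullyRamified hG hρ
    -- With the indices from `0`, a degree `f j` with `j < i` has `j + 1 ≤ i`, so the induction
    -- hypothesis covers this term.
    have hle : (⊤ : Subgroup G).lowerCentralSeries (i : ℕ) ≤ H := by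
      intro y hy
      by_contra hyH
      obtain ⟨e, σ, hσ, hσH, hne⟩ := exists_isIrreducible_ne_one h.normal hyH
      rcases lt_or_eq_one_of_isFullyRamified hG hρ h hσ hσH with hlt | h1
      · obtain ⟨j, rfl⟩ : e ∈ Set.range f := by
          rw [hrange]
          exact ⟨_, character_mem_irr hσ, by simp⟩
        have hji : j < i := hf.lt_iff_lt.1 hlt
        exact hne (ih j hji σ hσ y (Subgroup.lowerCentralSeries_antitone _ hji hy))
      · exact hne (h1 y)
    exact h.eq_one_of_mem_commutator (Subgroup.commutator_mono hle le_rfl hx)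

theorem lowerCentralSeries_eq_bot [Finite G] (hG : IsNMIGroup G) {n : ℕ} {f : Fin n → ℕ}
    (hf : StrictMono f) (hrange : Set.range f = charDegrees G) :
    (⊤ : Subgroup G).lowerCentralSeries n = ⊥ := by
  rw [eq_bot_iff]
  intro x hx
  by_contra hx1
  obtain ⟨e, σ, hσ, -, hne⟩ := exists_isIrreducible_ne_one Subgroup.normal_bot hx1
  obtain ⟨i, rfl⟩ : e ∈ Set.range f := by
    rw [hrange]
    exact ⟨_, character_mem_irr hσ, by simp⟩
  exact hne (lowerCentralSeries_acts_trivially hG hf hrange i σ hσ x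
    (Subgroup.lowerCentralSeries_antitone _ i.isLt hx))

theorem nilpotencyClass_le_of_lowerCentralSeries_eq_bot {n : ℕ}
    (h : (⊤ : Subgroup G).lowerCentralSeries n = ⊥) :
    ∃ _ : Group.IsNilpotent G, Group.nilpotencyClass G ≤ n := by
  classical
  have hN : Group.IsNilpotent G := Subgroup.nilpotent_iff_lowerCentralSeries.2 ⟨n, h⟩
  refine ⟨hN, ?_⟩
  rw [← Subgroup.lowerCentralSeries_length_eq_nilpotencyClass]
  exact Nat.find_min' _ h

/-! ### Clifford theory and invariant nMI-subgroups -/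

/-- Every irreducible character of a subgroup lies under an irreducible character of the group. -/
theorem exists_intertwiner_of_subgroup [Finite G] (N : Subgroup G) {e : ℕ}
    {σ : Representation ℂ N (Fin e → ℂ)} (hσ : σ.IsIrreducible) :
    ∃ (d : ℕ) (ρ : Representation ℂ G (Fin d → ℂ)), ρ.IsIrreducible ∧
      ∃ f : (Fin e → ℂ) →ₗ[ℂ] (Fin d → ℂ), f ≠ 0 ∧ ∀ (n : N) w, f (σ n w) = ρ n (f w) := by
  classical
  have := Fintype.ofFinite N
  obtain ⟨d, ρ, hρ, hne⟩ := exists_isIrreducible_sum_smul_ne_zero (fun n : N => (n : G))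
    (fun n => σ.character n⁻¹) (by simpa using natCast_ne_zero_of_isIrreducible hσ)
  refine ⟨d, ρ, hρ, ?_⟩
  by_contra! hno
  apply hne
  -- Averaging any `A` gives an intertwiner. Rank-one maps `A` then recover `∑ χ_σ(n⁻¹) ρ(n)` as a
  -- sum over the diagonal entries of `σ`.
  have key : ∀ (A : (Fin e → ℂ) →ₗ[ℂ] (Fin d → ℂ)), ∑ n : N, ρ n ∘ₗ A ∘ₗ σ n⁻¹ = 0 := by
    intro A
    by_contra h0
    obtain ⟨x, w, hx⟩ := hno _ h0
    apply hx
    simp only [LinearMap.sum_apply, LinearMap.comp_apply, map_sum]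
    rw [← Equiv.sum_comp (Equiv.mulLeft x)]
    refine Finset.sum_congr rfl fun n _ => ?_
    simp only [Equiv.coe_mulLeft, ← Module.End.mul_apply, ← map_mul, Subgroup.coe_mul, mul_inv_rev,
      inv_mul_cancel_right]
  refine LinearMap.ext fun u => ?_
  have h1 : ∀ i : Fin e, ∑ n : N, (σ n⁻¹ (Pi.single i 1) i) • ρ n u = 0 := by
    intro i
    have := LinearMap.congr_fun (key ((LinearMap.proj i).smulRight u)) (Pi.single i 1)
    simpa [LinearMap.sum_apply] using this
  have h2 : ∀ n : N, σ.character n⁻¹ = ∑ i, σ n⁻¹ (Pi.single i 1) i := by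
    intro n
    rw [Representation.character, LinearMap.trace_eq_matrix_trace ℂ (Pi.basisFun ℂ (Fin e))]
    simp [Matrix.trace]
  simp only [h2, LinearMap.sum_apply, LinearMap.smul_apply, Finset.sum_smul, LinearMap.zero_apply]
  rw [Finset.sum_comm]
  exact Finset.sum_eq_zero fun i _ => h1 i

/-- If an irreducible representation `ρ` of `G` lies over the representation `σ` of a normal
subgroup `N`, then so does every representation of `G` whose restriction to `N` admits a nonzero
homomorphism from the restriction of `ρ`. -/
theorem exists_intertwiner_of_common_constituent {N : Subgroup G} (hN : N.Normal)
    {V W U : Type*} [AddCommGroup V] [Module ℂ V] [AddCommGroup W] [Module ℂ W]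
    [AddCommGroup U] [Module ℂ U]
    {σ : Representation ℂ N W} {ρ : Representation ℂ G V} {τ : Representation ℂ G U}
    (hρ : ρ.IsIrreducible)
    {f : W →ₗ[ℂ] V} (hf0 : f ≠ 0) (hf : ∀ (n : N) w, f (σ n w) = ρ n (f w))
    {T : V →ₗ[ℂ] U} (hT0 : T ≠ 0) (hT : ∀ (n : N) v, T (ρ n v) = τ n (T v)) :
    ∃ F : W →ₗ[ℂ] U, F ≠ 0 ∧ ∀ (n : N) w, F (σ n w) = τ n (F w) := by
  obtain ⟨g, w, hgw⟩ : ∃ g w, T (ρ g (f w)) ≠ 0 := by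
    by_contra! h
    let p : Submodule ℂ V :=
      { carrier := {v | ∀ g, T (ρ g v) = 0}
        add_mem' := fun {a b} ha hb g => by rw [map_add, map_add, ha g, hb g, add_zero]
        zero_mem' := fun g => by simp
        smul_mem' := fun c a ha g => by rw [map_smul, map_smul, ha g, smul_zero] }
    have hp : p = ⊤ := by
      refine submodule_eq_top_of_isIrreducible hρ p (fun x v hv g => ?_) fun h0 => hf0 ?_
      · rw [← Module.End.mul_apply, ← map_mul]
        exact hv (g * x)
      · refine LinearMap.ext fun w => ?_
        have : f w ∈ p := fun g => h g w
        rwa [h0, Submodule.mem_bot] at this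
    refine hT0 (LinearMap.ext fun v => ?_)
    have : v ∈ p := hp ▸ Submodule.mem_top
    simpa using this 1
  -- `T ∘ ρ g ∘ f` intertwines only up to conjugation by `g`; `τ g⁻¹` undoes the twist.
  refine ⟨τ g⁻¹ ∘ₗ T ∘ₗ ρ g ∘ₗ f, fun h0 => hgw ?_, fun n w => ?_⟩
  · have := congrArg (τ g) (LinearMap.congr_fun h0 w)
    simpa [← Module.End.mul_apply, ← map_mul] using this
  · let k : N := ⟨g * n * g⁻¹, hN.conj_mem n n.2 g⟩
    have h1 : ρ g (ρ n (f w)) = ρ k (ρ g (f w)) := by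
      simp [k, ← Module.End.mul_apply, ← map_mul]
    have h2 : ∀ u, τ g⁻¹ (τ k u) = τ n (τ g⁻¹ u) := fun u => by
      simp [k, ← Module.End.mul_apply, ← map_mul, mul_assoc]
    simp only [LinearMap.comp_apply]
    rw [hf, h1, hT, h2]

theorem isInvNMISubgroup_of_normal [Finite G] (hG : IsNMIGroup G) {N : Subgroup G}
    (hN : N.Normal) : IsInvNMISubgroup N := by
  classical
  refine ⟨hN, ?_⟩
  rintro _ ⟨e, σ, hσ, rfl⟩
  obtain ⟨d, ρ, hρ, f, hf0, hf⟩ := exists_intertwiner_of_subgroup N hσ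
  obtain ⟨Z, l, hZ⟩ := exists_isFullyRamified hG hρ
  have hZn := hZ.normal
  let H : Subgroup G := Z ⊓ N
  have hHn : H.Normal := inferInstance
  let m : H →* ℂ := l.comp (Subgroup.inclusion inf_le_left)
  have hm : ∀ (g : G) (h : H), m (MulAut.conjNormal g h) = m h := fun g h =>
    hZ.invariant g (Subgroup.inclusion inf_le_left h)
  have hρH : ∀ h : H, ρ h = m h • 1 := fun h => hZ.eq_smul_one (Subgroup.inclusion inf_le_left h)
  refine ⟨H, m, inf_le_right, hHn, ⟨monoidHom_mem_irr m, map_one m, hm⟩, ?_⟩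
  refine Set.Subset.antisymm ?_ ?_
  · rintro χ hχ
    obtain ⟨c, τ, hτ, rfl⟩ := hχ.1
    rw [character_mem_irrOver_iff hτ] at hχ
    obtain ⟨F, hF0, hF⟩ := hχ
    rw [character_mem_irrOver_linear_iff m hτ]
    -- As `σ` embeds in `ρ`, the group `H` already acts on `σ` by `m`.
    have hf_inj : Function.Injective f := by
      let f' : IntertwiningMap σ (ρ.comp N.subtype) := ⟨f, fun n => LinearMap.ext (hf n)⟩
      exact (IsIrreducible.injective_or_eq_zero f').resolve_right fun h0 =>
        hf0 (congrArg IntertwiningMap.toLinearMap h0)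
    obtain ⟨w, hw⟩ : ∃ w, F w ≠ 0 := by
      by_contra! h
      exact hF0 (LinearMap.ext h)
    refine ⟨F w, hw, fun h => ?_⟩
    have h1 : σ (Subgroup.inclusion inf_le_right h) w = m h • w := hf_inj (by
      rw [hf, map_smul]
      exact LinearMap.congr_fun (hρH h) (f w))
    rw [← map_smul, ← h1, hF]
    rfl
  · rintro χ hχ
    obtain ⟨c, τ, hτ, rfl⟩ := hχ.1
    rw [character_mem_irrOver_iff_eq_smul_one m hm hτ] at hχ
    rw [character_mem_irrOver_iff hτ]
    -- On `N` the character of `ρ` vanishes off `H`, and on `H` the scalars `m(y)` and `m(y⁻¹)`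
    -- cancel, so each term is `c * d`.
    have hinner : charInner (Representation.character (τ.comp N.subtype))
        (Representation.character (ρ.comp N.subtype)) ≠ 0 := by
      have := Fintype.ofFinite N
      rw [charInner, finsum_eq_sum_of_fintype]
      refine mul_ne_zero (by simp) ?_
      rw [sum_eq_sum_subgroup (H.subgroupOf N) _ fun n hn => ?_]
      · have h1 : ∀ x : H.subgroupOf N, Representation.character (τ.comp N.subtype) (x : N) *
            Representation.character (ρ.comp N.subtype) (x : N)⁻¹ = c * d := by
          intro x
          let y : H := ⟨((x : N) : G), x.2⟩
          have h2 := character_of_eq_smul_one hχ y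
          have h3 := character_of_eq_smul_one hρH y⁻¹
          change τ.character y * ρ.character (y⁻¹ : H) = _
          rw [h2, h3]
          linear_combination (c * d : ℂ) * inv_apply_mul_apply m y
        simp [h1, natCast_ne_zero_of_isIrreducible hτ, natCast_ne_zero_of_isIrreducible hρ]
      · have : (n : G)⁻¹ ∉ Z := fun h => hn
          (Subgroup.mem_subgroupOf.2 ⟨by simpa using Z.inv_mem h, n.2⟩)
        have h2 : Representation.character (ρ.comp N.subtype) n⁻¹ = 0 :=
          hZ.character_eq_zero _ this
        rw [h2, mul_zero]
    obtain ⟨T, hT0, hT⟩ := (charInner_character_ne_zero_iff _ _).1 hinner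
    exact exists_intertwiner_of_common_constituent hN hρ hf0 hf hT0 hT

end

end NMI

end

theorem corollary3p21 (G : Type*) [Group G] [Finite G] (hG : NMI.IsNMIGroup G)
    (n : ℕ) (f : Fin n → ℕ) (hf : StrictMono f) (hrange : Set.range f = NMI.charDegrees G) :
    (∀ (i : Fin n), ∀ χ ∈ NMI.irr G, χ 1 = (f i : ℂ) →
      -- Mathlib's series starts at index `0` and `i` runs through `0, …, n - 1`
      ((⊤ : Subgroup G).lowerCentralSeries ((i : ℕ) + 1) : Set G) ⊆ NMI.charKer χ) ∧
    (∃ _ : Group.IsNilpotent G, Group.nilpotencyClass G ≤ n) ∧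
    (∀ N : Subgroup G, N.Normal → NMI.IsInvNMISubgroup N) := by
  refine ⟨?_, NMI.nilpotencyClass_le_of_lowerCentralSeries_eq_bot
    (NMI.lowerCentralSeries_eq_bot hG hf hrange), fun N hN => NMI.isInvNMISubgroup_of_normal hG hN⟩
  rintro i _ ⟨d, ρ, hρ, rfl⟩ hd x hx
  obtain rfl : d = f i := by simpa using hd
  change ρ.character x = ρ.character 1
  rw [Representation.character,
    NMI.lowerCentralSeries_acts_trivially hG hf hrange i ρ hρ x hx, Representation.character,
    map_one ρ]
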